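/- For $z\in\mathbb{C}$ with $\operatorname{Re} z<0$ and $\alpha\in\mathbb{R}$ with $\alpha>|\operatorname{Im} z|$, put $$f_\alpha(z,x):=\frac{1}{2\pi\mathrm{i}}\left(\frac{\mathrm{e}^{\mathrm{i}\alpha}}{z-\mathrm{i}\alpha+x}-\frac{\mathrm{e}^{-\mathrm{i}\alpha}}{z+\mathrm{i}\alpha+x}\right)\mathrm{e}^{-x},\qquad I_\alpha(z):=\int_0^\infty f_\alpha(z,x)\,\mathrm{d}x,$$ and, with $\phi(t):=\log(1+\exp(\pi\sinh t))$, let the double-exponential formula with $2n+1$ nodes and grid spacing $h>0$ be $$\tilde I_{\alpha,n,h}(z):=h\sum_{k=-n}^{n}f_\alpha(z,\phi(kh))\,\phi'(kh).$$ **Theorem.** There are real constants $c_d>0$ ($d\in\mathbb{R}$), each depending only on $d$, such that the following holds. Let $z\in\mathbb{C}$ with $\operatorname{Re} z<0$, let $\alpha\in\mathbb{R}$ with $|\operatorname{Im} z|+2\pi<\alpha$, and let $d\in\mathbb{R}$ satisfy $$0<d<\arctan\left(\frac{\alpha-|\operatorname{Im} z|-2\pi}{-\operatorname{Re} z+\log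 2}\right).$$ Then $f_\alpha(z,\cdot)$ is integrable on $[0,\infty)$ and, for every positive integer $n$ with $n>1/(4d)$, setting $h:=\log(4dn)/n$, $$|I_\alpha(z)-\tilde I_{\alpha,n,h}(z)|\le c_d\,K_{z,\alpha,d}\,\exp\left(-\frac{2\pi dn}{\log(4dn)}\right),$$ where $$K_{z,\alpha,d}:=\frac{1/\pi}{(\alpha-|\operatorname{Im} z|-2\pi)\cos d-(-\operatorname{Re} z+\log 2)\sin d}.$$ -/

import Mathlib

noncomputable section

/-- The integrand `f_α(z, x)`, as a function of a complex variable `x`. -/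
def fAlpha (α : ℝ) (z x : ℂ) : ℂ :=
  1 / (2 * (Real.pi : ℂ) * Complex.I) *
    (Complex.exp (Complex.I * α) / (z - Complex.I * α + x) -
      Complex.exp (-(Complex.I * α)) / (z + Complex.I * α + x)) * Complex.exp (-x)

/-- The integral `I_α(z)` of `f_α(z, ·)` over the half-line `[0, ∞)`. -/
def IAlpha (α : ℝ) (z : ℂ) : ℂ :=
  ∫ x in Set.Ioi (0 : ℝ), fAlpha α z (x : ℂ)

/-- The double-exponential variable transformation `φ(t) = log (1 + exp (π sinh t))`. -/
def dePhi (t : ℝ) : ℝ :=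
  Real.log (1 + Real.exp (Real.pi * Real.sinh t))

/-- The double-exponential formula for `I_α(z)` with the `2 n + 1` nodes
`k = -n, …, n` and grid spacing `h`. -/
def deApprox (α : ℝ) (n : ℕ) (h : ℝ) (z : ℂ) : ℂ :=
  (h : ℂ) * ∑ k ∈ Finset.Icc (-(n : ℤ)) (n : ℤ),
    fAlpha α z ((dePhi ((k : ℝ) * h) : ℝ) : ℂ) * ((deriv dePhi ((k : ℝ) * h) : ℝ) : ℂ)

/-- The constant `K_{z, α, d}`. -/
def KConst (z : ℂ) (α d : ℝ) : ℝ :=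
  (1 / Real.pi) /
    ((α - |z.im| - 2 * Real.pi) * Real.cos d - (-z.re + Real.log 2) * Real.sin d)

end

/-!
The substitution `x = φ(t)` turns `I_α(z)` into the integral over `ℝ` of
`F(t) = f_α(z, φ(t)) φ'(t)` (`deIntegrand`), and the double-exponential formula is the trapezoidal
rule for `F`, truncated to `|k| ≤ n`.

*Geometry.* `φ` continues holomorphically to the strip `|Im t| < π / 2` as
`logOneAddExp (π sinh t)`. For `|Im t| ≤ d` the values of `φ` with nonnegative real part lie between
the lines `|Im| = 2π + (Re + log 2) tan d`, while those with negative real part have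
`|Im| ≤ 2π + log 2 * tan d` (`abs_im_logOneAddExp_mul_cos_le`). The poles `-z ± iα` of `f_α(z, ·)`
lie in the right half-plane outside these lines, at distance at least `1 / (π K)`, where
`K = KConst z α d`; hence `‖F t‖ ≤ K ‖deWeight t‖` (`norm_deIntegrand_le`), with a weight that
depends neither on `z` nor on `α` and is at most `C / (1 + (Re t)²)` on the strip
(`exists_norm_deWeight_le`).

*Discretization.* By Poisson summation the error of the untruncated trapezoidal rule with spacing
`h` is the sum of the Fourier integrals of `F` at the nonzero multiples of `1 / h`. Shifting the
line of integration to `Im t = ± d` shows that these decay like powers of `exp (-2πd / h)`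
(`norm_integral_sub_tsum_le`).

*Truncation.* On the real axis the weight is at most `π cosh t exp (-π sinh |t|)`, so that the
discarded terms sum to at most `2 K exp (-π sinh (n h))`. For `h = log (4dn) / n` this is
`O(K exp (-2πdn))`, which is dominated by the bound for the discretization error. Since `n > 1 / (4d)` is an integer,
`log (4dn)` is bounded below by a positive number depending on `d` only, and this makes the
comparison uniform even where `log (4dn) < 1`.
-/

/-! ### Series over the integers -/

/-- A symmetric partial sum of a series over `ℤ` differs from the whole sum by at most twice the
tail of a majorant that depends on `|k|` only. This bounds both the truncation error (`n` as given)
and the discretization error, where only the zeroth Fourier coefficient is split off (`n = 0`). -/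
theorem norm_tsum_sub_sum_Icc_le {f : ℤ → ℂ} {u : ℕ → ℝ} {n : ℕ} {S : ℝ}
    (hu : HasSum (fun j : ℕ => u (j + n + 1)) S)
    (hf : ∀ k : ℤ, n < k.natAbs → ‖f k‖ ≤ u k.natAbs) :
    Summable f ∧ ‖∑' k, f k - ∑ k ∈ Finset.Icc (-(n : ℤ)) n, f k‖ ≤ 2 * S := by
  classical
  set s := Finset.Icc (-(n : ℤ)) n with hs
  set g : ℤ → ℂ := fun k => if k ∈ s then 0 else f k with hg
  set v : ℕ → ℝ := fun j => if j < n then 0 else u (j + 1) with hv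
  have hvS : HasSum v S := by
    rw [← hasSum_nat_add_iff' n]
    have h0 : ∑ i ∈ Finset.range n, v i = 0 :=
      Finset.sum_eq_zero fun i hi => if_pos (Finset.mem_range.1 hi)
    rw [h0, sub_zero]
    refine hu.congr_fun ?_
    intro j
    simp [hv]
  have hb : ∀ (k : ℤ) (j : ℕ), k.natAbs = j + 1 → ‖g k‖ ≤ v j := by
    intro k j hk
    by_cases h : j < n
    · have : k ∈ s := by rw [hs, Finset.mem_Icc]; omega
      simp [hg, hv, this, h]
    · have : k ∉ s := by rw [hs, Finset.mem_Icc]; omega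
      simp only [hg, hv, this, h, if_false]
      rw [← hk]
      exact hf k (by omega)
  have h1 : ∀ j : ℕ, ‖g ((j : ℤ) + 1)‖ ≤ v j := fun j => hb _ _ (by omega)
  have h2 : ∀ j : ℕ, ‖g (-((j : ℤ) + 1))‖ ≤ v j := fun j => hb _ _ (by omega)
  have s1 : Summable fun j : ℕ => g ((j : ℤ) + 1) := .of_norm_bounded hvS.summable h1
  have s2 : Summable fun j : ℕ => g (-((j : ℤ) + 1)) := .of_norm_bounded hvS.summable h2
  have hgs := HasSum.of_add_one_of_neg_add_one s1.hasSum s2.hasSum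
  have g0 : g 0 = 0 := if_pos (by rw [hs, Finset.mem_Icc]; omega)
  have hfs : HasSum (fun k => if k ∈ s then f k else 0) (∑ k ∈ s, f k) := by
    have := hasSum_sum_of_ne_finset_zero (f := fun k => if k ∈ s then f k else 0) (s := s)
      (L := SummationFilter.unconditional ℤ) (fun k hk => if_neg hk)
    rwa [Finset.sum_congr rfl (fun k hk => if_pos hk)] at this
  have hft := hgs.add hfs
  have hfe : (fun k => g k + if k ∈ s then f k else 0) = f := by
    funext k
    by_cases h : k ∈ s <;> simp [hg, h]
  rw [hfe] at hft
  refine ⟨hft.summable, ?_⟩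
  rw [hft.tsum_eq, add_sub_cancel_right, g0, add_zero, two_mul]
  exact (norm_add_le _ _).trans
    (add_le_add (tsum_of_norm_bounded hvS h1) (tsum_of_norm_bounded hvS h2))

/-! ### The trapezoidal rule for functions holomorphic in a strip -/

/-- Shift of the line of integration inside a strip of holomorphy. -/
theorem integral_add_mul_I_eq {G : ℂ → ℂ} {c M : ℝ}
    (hd : ∀ t : ℂ, |t.im| ≤ |c| → DifferentiableAt ℂ G t)
    (hb : ∀ t : ℂ, |t.im| ≤ |c| → ‖G t‖ ≤ M * (1 + t.re ^ 2)⁻¹) :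
    ∫ x : ℝ, G (x + c * Complex.I) = ∫ x : ℝ, G x := by
  have key : ∀ y : ℝ, |y| ≤ |c| →
      MeasureTheory.Integrable (fun x : ℝ => G (x + y * Complex.I)) := by
    intro y hy
    refine (integrable_inv_one_add_sq.const_mul M).mono' ?_ (.of_forall fun x => ?_)
    · refine Continuous.aestronglyMeasurable ?_
      refine continuous_iff_continuousAt.2 fun x => ?_
      exact ContinuousAt.comp (f := fun x : ℝ => (x : ℂ) + y * Complex.I)
        (hd _ (by simpa using hy)).continuousAt (by fun_prop)
    · simpa using hb (x + y * Complex.I) (by simpa using hy)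
  have i0 : MeasureTheory.Integrable (fun x : ℝ => G x) := by simpa using key 0 (by simp)
  have ic := key c le_rfl
  have l0 := MeasureTheory.intervalIntegral_tendsto_integral i0 Filter.tendsto_neg_atTop_atBot
    Filter.tendsto_id
  have lc := MeasureTheory.intervalIntegral_tendsto_integral ic Filter.tendsto_neg_atTop_atBot
    Filter.tendsto_id
  -- the vertical sides of the rectangle `[-T, T] × [0, c]` contribute `O(1 / (1 + T²))`
  have hv : ∀ T : ℝ, ‖∫ y in (0 : ℝ)..c, G (T + y * Complex.I)‖ ≤ M * (1 + T ^ 2)⁻¹ * |c| := by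
    intro T
    have := intervalIntegral.norm_integral_le_of_norm_le_const (a := (0 : ℝ)) (b := c)
      (f := fun y : ℝ => G (T + y * Complex.I)) (C := M * (1 + T ^ 2)⁻¹) (fun y hy => ?_)
    · simpa using this
    · have hy' : |y| ≤ |c| := by
        rcases le_total 0 c with h | h
        · rw [Set.uIoc_of_le h] at hy
          rw [abs_of_pos hy.1, abs_of_nonneg h]; exact hy.2
        · rw [Set.uIoc_of_ge h] at hy
          rw [abs_of_nonpos hy.2, abs_of_nonpos h]; linarith [hy.1]
      simpa using hb (T + y * Complex.I) (by simpa using hy')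
  have hrect : ∀ T : ℝ, (∫ x in -T..T, G x) - (∫ x in -T..T, G (x + c * Complex.I)) =
      Complex.I * (∫ y in (0 : ℝ)..c, G ((-T : ℝ) + y * Complex.I)) -
      Complex.I * (∫ y in (0 : ℝ)..c, G (T + y * Complex.I)) := by
    intro T
    have := Complex.integral_boundary_rect_eq_zero_of_differentiableOn G ⟨-T, 0⟩ ⟨T, c⟩ ?_
    · simp only [Complex.ofReal_zero, zero_mul, add_zero, smul_eq_mul] at this
      linear_combination this
    · intro t ht
      refine (hd t ?_).differentiableWithinAt
      have h := (Complex.mem_reProdIm.1 ht).2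
      simpa using Set.abs_sub_left_of_mem_uIcc h
  have hz : Filter.Tendsto (fun T : ℝ => M * (1 + T ^ 2)⁻¹ * |c| + M * (1 + T ^ 2)⁻¹ * |c|)
      Filter.atTop (nhds 0) := by
    have : Filter.Tendsto (fun T : ℝ => (1 + T ^ 2)⁻¹) Filter.atTop (nhds 0) :=
      (Filter.tendsto_atTop_add_const_left _ _
        (Filter.tendsto_pow_atTop two_ne_zero)).inv_tendsto_atTop
    have h2 := (this.const_mul M).mul_const |c|
    simpa using h2.add h2
  have hdiff := squeeze_zero_norm (f := fun T : ℝ => (∫ x in -T..T, G x) -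
    (∫ x in -T..T, G (x + c * Complex.I))) (fun T => ?_) hz
  · have := tendsto_nhds_unique (l0.sub lc) hdiff
    exact (sub_eq_zero.1 this).symm
  · rw [hrect]
    refine (norm_sub_le _ _).trans (add_le_add ?_ ?_)
    · simpa using hv (-T)
    · simpa using hv T

/-- The Fourier integral of a function holomorphic in the strip `|Im t| ≤ d` decays like
`exp (-d |w|)`. -/
theorem norm_integral_exp_mul_le {F : ℂ → ℂ} {d M : ℝ} (hd : 0 ≤ d)
    (hF : ∀ t : ℂ, |t.im| ≤ d → DifferentiableAt ℂ F t)
    (hb : ∀ t : ℂ, |t.im| ≤ d → ‖F t‖ ≤ M * (1 + t.re ^ 2)⁻¹) (w : ℝ) :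
    ‖∫ x : ℝ, Complex.exp (w * x * Complex.I) * F x‖ ≤ M * Real.pi * Real.exp (-d * |w|) := by
  -- the contour is moved to the side on which the exponential decays
  obtain ⟨c, hc, hcw⟩ : ∃ c : ℝ, |c| = d ∧ w * c = d * |w| := by
    rcases le_total 0 w with h | h
    · exact ⟨d, abs_of_nonneg hd, by rw [abs_of_nonneg h]; ring⟩
    · exact ⟨-d, by rw [abs_neg, abs_of_nonneg hd], by rw [abs_of_nonpos h]; ring⟩
  have hnorm : ∀ t : ℂ, ‖Complex.exp (w * t * Complex.I)‖ = Real.exp (-(w * t.im)) := by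
    intro t; rw [Complex.norm_exp]; simp
  have hM : 0 ≤ M := by simpa using (norm_nonneg _).trans (hb 0 (by simpa using hd))
  rw [← integral_add_mul_I_eq (G := fun t => Complex.exp (w * t * Complex.I) * F t) (c := c)
    (M := Real.exp (|w| * d) * M)]
  · have hle : ∀ x : ℝ, ‖Complex.exp (w * (x + c * Complex.I) * Complex.I) *
        F (x + c * Complex.I)‖ ≤ M * Real.exp (-d * |w|) * (1 + x ^ 2)⁻¹ := by
      intro x
      have := hb (x + c * Complex.I) (by simpa using hc.le)
      rw [norm_mul, hnorm]
      simp only [Complex.add_re, Complex.ofReal_re, Complex.mul_re, Complex.I_re, mul_zero,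
        Complex.ofReal_im, Complex.I_im, mul_one, sub_self, add_zero, Complex.add_im,
        Complex.mul_im, zero_add] at this ⊢
      rw [hcw, neg_mul, mul_right_comm, mul_comm (Real.exp _)]
      gcongr
    refine (MeasureTheory.norm_integral_le_of_norm_le
      (integrable_inv_one_add_sq.const_mul _) (.of_forall hle)).trans (le_of_eq ?_)
    rw [MeasureTheory.integral_const_mul, integral_univ_inv_one_add_sq]
    ring
  · intro t ht
    exact (by fun_prop : DifferentiableAt ℂ (fun t : ℂ => Complex.exp (w * t * Complex.I)) t).mul
      (hF t (ht.trans hc.le))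
  · intro t ht
    rw [hc] at ht
    rw [norm_mul, hnorm, mul_assoc]
    refine mul_le_mul (Real.exp_le_exp.2 ?_) (hb t ht) (norm_nonneg _) (Real.exp_pos _).le
    calc -(w * t.im) ≤ |w * t.im| := neg_le_abs _
      _ = |w| * |t.im| := abs_mul _ _
      _ ≤ |w| * d := by gcongr

theorem mul_fourier_comp_mul_right (F : ℂ → ℂ) {h : ℝ} (hh : 0 < h) (w : ℝ) :
    h * FourierTransform.fourier (fun x : ℝ => F ((x * h : ℝ) : ℂ)) w =
      ∫ x : ℝ, Complex.exp ((-2 * Real.pi * w / h : ℝ) * x * Complex.I) * F x := by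
  rw [Real.fourier_real_eq_integral_exp_smul]
  have := MeasureTheory.Measure.integral_comp_mul_right (fun x : ℝ =>
    Complex.exp ((-2 * Real.pi * w / h : ℝ) * x * Complex.I) * F x) h
  have e : (fun v : ℝ => Complex.exp (((-2 * Real.pi * v * w : ℝ) : ℂ) * Complex.I) •
      F ((v * h : ℝ) : ℂ)) =
      fun v : ℝ => Complex.exp ((-2 * Real.pi * w / h : ℝ) * ((v * h : ℝ) : ℂ) * Complex.I) *
        F ((v * h : ℝ) : ℂ) := by
    funext v
    rw [smul_eq_mul, ← Complex.ofReal_mul]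
    congr 4
    field_simp
  rw [e, this, abs_of_pos (inv_pos.2 hh), Complex.real_smul, ← mul_assoc, Complex.ofReal_inv,
    mul_inv_cancel₀ (by exact_mod_cast hh.ne'), one_mul]

/-- The trapezoidal rule with spacing `h` for a function holomorphic in the strip `|Im t| ≤ d` has
error `O(exp (-2πd / h))`, by Poisson summation. -/
theorem norm_integral_sub_tsum_le {F : ℂ → ℂ} {d M h : ℝ} (hd : 0 < d) (hh : 0 < h)
    (hF : ∀ t : ℂ, |t.im| ≤ d → DifferentiableAt ℂ F t)
    (hb : ∀ t : ℂ, |t.im| ≤ d → ‖F t‖ ≤ M * (1 + t.re ^ 2)⁻¹) :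
    ‖(∫ x : ℝ, F x) - h * ∑' k : ℤ, F ((k * h : ℝ) : ℂ)‖ ≤
      2 * (M * Real.pi * (Real.exp (-(2 * Real.pi * d / h)) /
        (1 - Real.exp (-(2 * Real.pi * d / h))))) := by
  set q := Real.exp (-(2 * Real.pi * d / h)) with hq
  have hq1 : q < 1 := by
    rw [hq, Real.exp_lt_one_iff, neg_lt_zero]; positivity
  have hq0 : 0 ≤ q := (Real.exp_pos _).le
  have hM : 0 ≤ M := by simpa using (norm_nonneg _).trans (hb 0 (by simpa using hd.le))
  set g : ℝ → ℂ := fun x => F ((x * h : ℝ) : ℂ) with hg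
  have hcont : Continuous g := by
    refine continuous_iff_continuousAt.2 fun x => ?_
    exact ContinuousAt.comp (f := fun x : ℝ => ((x * h : ℝ) : ℂ))
      (hF _ (by simpa using hd.le)).continuousAt (by fun_prop)
  have hdecay : g =O[Filter.cocompact ℝ] fun x : ℝ => |x| ^ (-2 : ℝ) := by
    refine Asymptotics.IsBigO.of_bound (M * (h ^ 2)⁻¹) ?_
    have hne : ∀ᶠ x : ℝ in Filter.cocompact ℝ, x ≠ 0 := by
      have := (isCompact_singleton (x := (0 : ℝ))).compl_mem_cocompact
      filter_upwards [this] with x hx using hx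
    filter_upwards [hne] with x hx
    have h1 := hb ((x * h : ℝ) : ℂ) (by simpa using hd.le)
    rw [Complex.ofReal_re] at h1
    refine h1.trans ?_
    rw [Real.rpow_neg (abs_nonneg _), Real.rpow_two, sq_abs, norm_inv, norm_pow, Real.norm_eq_abs,
      sq_abs, mul_assoc, ← mul_inv]
    have : 0 < h ^ 2 * x ^ 2 := by positivity
    gcongr
    nlinarith
  have hfour : ∀ m : ℤ, h * FourierTransform.fourier g (m : ℝ) =
      ∫ x : ℝ, Complex.exp ((-2 * Real.pi * m / h : ℝ) * x * Complex.I) * F x :=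
    fun m => mul_fourier_comp_mul_right F hh m
  have hbound : ∀ m : ℤ, ‖h * FourierTransform.fourier g (m : ℝ)‖ ≤
      M * Real.pi * q ^ m.natAbs := by
    intro m
    rw [hfour]
    refine (norm_integral_exp_mul_le hd.le hF hb _).trans (le_of_eq ?_)
    rw [hq, ← Real.exp_nat_mul, Nat.cast_natAbs, Int.cast_abs, abs_div, abs_mul, abs_mul,
      abs_of_pos hh, abs_of_pos Real.pi_pos]
    congr 2
    norm_num
    ring
  have hsum : HasSum (fun j : ℕ => M * Real.pi * q ^ (j + 0 + 1)) (M * Real.pi * (q / (1 - q))) := by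
    rw [div_eq_mul_inv, ← mul_assoc]
    exact ((hasSum_geometric_of_lt_one hq0 hq1).mul_left (M * Real.pi * q)).congr_fun
      fun j => by rw [add_zero, pow_succ]; ring
  obtain ⟨hs, hle⟩ := norm_tsum_sub_sum_Icc_le (n := 0) (u := fun j => M * Real.pi * q ^ j) hsum
    (fun m _ => hbound m)
  have hh' : (h : ℂ) ≠ 0 := by exact_mod_cast hh.ne'
  have hs' : Summable fun m : ℤ => FourierTransform.fourier g (m : ℝ) :=
    (summable_mul_left_iff hh').1 hs
  have hP := Real.tsum_eq_tsum_fourier_of_rpow_decay_of_summable hcont one_lt_two hdecay hs' 0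
  have hP' : ∑' k : ℤ, F ((k * h : ℝ) : ℂ) = ∑' m : ℤ, FourierTransform.fourier g (m : ℝ) := by
    simpa [hg] using hP
  have h0 := hfour 0
  rw [hP', ← tsum_mul_left, ← norm_neg, neg_sub]
  have h00 : (h : ℂ) * FourierTransform.fourier g 0 = ∫ x : ℝ, F x := by simpa using h0
  simpa [h00] using hle

/-! ### Holomorphic continuation of `log (1 + exp w)` -/

/-- The holomorphic continuation of `log (1 + exp w)` from the real axis to the complex plane cut
along the rays `{i v | π ≤ |v|}`. The principal logarithm of `1 + exp w` is discontinuous for large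
positive `Re w`, which is why the identity `1 + exp w = exp w * (1 + exp (-w))` is used there. -/
noncomputable def logOneAddExp (w : ℂ) : ℂ :=
  if w.re < 0 then Complex.log (1 + Complex.exp w) else w + Complex.log (1 + Complex.exp (-w))

theorem one_add_exp_ne_zero {w : ℂ} (hw : w.re ≠ 0 ∨ |w.im| < Real.pi) :
    1 + Complex.exp w ≠ 0 := by
  intro h
  have h1 : Complex.exp w = -1 := by linear_combination h
  have hre : w.re = 0 := by
    have := congrArg norm h1
    rw [Complex.norm_exp, norm_neg, norm_one, Real.exp_eq_one_iff] at this
    exact this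
  rcases hw with hw | hw
  · exact hw hre
  · have h2 := Complex.log_exp (abs_lt.1 hw).1 (abs_lt.1 hw).2.le
    rw [h1, Complex.log_neg_one] at h2
    have h3 := congrArg Complex.im h2
    simp only [Complex.mul_im, Complex.ofReal_re, Complex.I_im, mul_one, Complex.ofReal_im,
      Complex.I_re, mul_zero, add_zero] at h3
    rw [← h3, abs_of_pos Real.pi_pos] at hw
    exact lt_irrefl _ hw

theorem one_add_exp_neg_ne_zero {w : ℂ} (hw : w.re ≠ 0 ∨ |w.im| < Real.pi) :
    1 + Complex.exp (-w) ≠ 0 :=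
  one_add_exp_ne_zero (by simpa using hw)

theorem re_one_add_exp_nonneg {w : ℂ} (hw : w.re ≤ 0) : 0 ≤ (1 + Complex.exp w).re := by
  have h1 := (abs_le.1 (Complex.abs_re_le_norm (Complex.exp w))).1
  rw [Complex.norm_exp] at h1
  have h2 := Real.exp_le_one_iff.2 hw
  rw [Complex.add_re, Complex.one_re]
  linarith

theorem re_one_add_exp_pos {w : ℂ} (hw : w.re < 0) : 0 < (1 + Complex.exp w).re := by
  have h1 := (abs_le.1 (Complex.abs_re_le_norm (Complex.exp w))).1
  rw [Complex.norm_exp] at h1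
  have h2 := Real.exp_lt_one_iff.2 hw
  rw [Complex.add_re, Complex.one_re]
  linarith

theorem abs_im_log_le {u : ℂ} (hu : 0 ≤ u.re) : |(Complex.log u).im| ≤ Real.pi / 2 := by
  rw [Complex.log_im]
  exact Complex.abs_arg_le_pi_div_two_iff.2 hu

theorem exp_logOneAddExp {w : ℂ} (hw : w.re ≠ 0 ∨ |w.im| < Real.pi) :
    Complex.exp (logOneAddExp w) = 1 + Complex.exp w := by
  rw [logOneAddExp]
  split_ifs
  · exact Complex.exp_log (one_add_exp_ne_zero hw)
  · rw [Complex.exp_add, Complex.exp_log (one_add_exp_neg_ne_zero hw), mul_add, mul_one,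
      ← Complex.exp_add, add_neg_cancel, Complex.exp_zero, add_comm]

theorem logOneAddExp_eq_log {w : ℂ} (hw : |w.im| < Real.pi) :
    logOneAddExp w = Complex.log (1 + Complex.exp w) := by
  rw [← exp_logOneAddExp (Or.inr hw)]
  by_cases h : w.re < 0
  · rw [logOneAddExp, if_pos h, Complex.exp_log (one_add_exp_ne_zero (Or.inr hw))]
  · rw [logOneAddExp, if_neg h]
    have harg := abs_le.1
      (abs_im_log_le (re_one_add_exp_nonneg (w := -w) (by simpa using not_lt.1 h)))
    obtain ⟨hw1, hw2⟩ := abs_lt.1 hw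
    have him : (1 + Complex.exp (-w)).im = -(Real.exp (-w.re) * Real.sin w.im) := by
      simp [Complex.exp_im]
    have hsign : -Real.pi < (w + Complex.log (1 + Complex.exp (-w))).im ∧
        (w + Complex.log (1 + Complex.exp (-w))).im ≤ Real.pi := by
      rw [Complex.add_im]
      have hpi := Real.pi_pos
      rcases lt_trichotomy w.im 0 with hb | hb | hb
      · have : 0 ≤ (Complex.log (1 + Complex.exp (-w))).im := by
          rw [Complex.log_im, Complex.arg_nonneg_iff, him]
          have := Real.sin_neg_of_neg_of_neg_pi_lt hb hw1
          have := mul_neg_of_pos_of_neg (Real.exp_pos (-w.re)) this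
          linarith
        constructor <;> linarith
      · constructor <;> linarith
      · have : (Complex.log (1 + Complex.exp (-w))).im < 0 := by
          rw [Complex.log_im, Complex.arg_neg_iff, him]
          have := Real.sin_pos_of_pos_of_lt_pi hb hw2
          have := mul_pos (Real.exp_pos (-w.re)) this
          linarith
        constructor <;> linarith
    rw [Complex.log_exp hsign.1 hsign.2]

theorem hasDerivAt_logOneAddExp {w : ℂ} (hw : w.re ≠ 0 ∨ |w.im| < Real.pi) :
    HasDerivAt logOneAddExp (1 / (1 + Complex.exp (-w))) w := by
  have hne := one_add_exp_ne_zero hw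
  have hne' := one_add_exp_neg_ne_zero hw
  have hmul : Complex.exp w * Complex.exp (-w) = 1 := by
    rw [← Complex.exp_add, add_neg_cancel, Complex.exp_zero]
  have hlog : 0 < (1 + Complex.exp w).re →
      HasDerivAt (fun w => Complex.log (1 + Complex.exp w)) (1 / (1 + Complex.exp (-w))) w := by
    intro h
    have := ((Complex.hasDerivAt_exp w).const_add 1).clog (Or.inl h)
    convert! this using 1
    rw [div_eq_div_iff hne' hne]
    linear_combination -hmul
  rcases lt_trichotomy w.re 0 with h | h | h
  · refine (hlog (re_one_add_exp_pos h)).congr_of_eventuallyEq ?_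
    filter_upwards [(isOpen_lt Complex.continuous_re continuous_const).mem_nhds h] with v hv
    exact if_pos hv
  · have him : |w.im| < Real.pi := hw.resolve_left (not_not.2 h)
    refine (hlog ?_).congr_of_eventuallyEq ?_
    · rw [Complex.add_re, Complex.one_re, Complex.exp_re, h, Real.exp_zero, one_mul,
        ← Real.cos_abs]
      have := Real.cos_lt_cos_of_nonneg_of_le_pi (abs_nonneg w.im) le_rfl him
      rw [Real.cos_pi] at this
      linarith
    · filter_upwards [(isOpen_lt Complex.continuous_im.abs continuous_const).mem_nhds him] with v hv
      exact logOneAddExp_eq_log hv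
  · have h1 : HasDerivAt (fun w : ℂ => 1 + Complex.exp (-w)) (-Complex.exp (-w)) w := by
      simpa using ((hasDerivAt_neg w).cexp).const_add 1
    have h2 := (hasDerivAt_id w).add
      (h1.clog (Or.inl (re_one_add_exp_pos (w := -w) (by simpa using h))))
    refine (h2.congr_deriv ?_).congr_of_eventuallyEq ?_
    · field_simp
      ring
    · filter_upwards [(isOpen_lt continuous_const Complex.continuous_re).mem_nhds h] with v hv
      exact if_neg (not_lt.2 (le_of_lt hv))

theorem abs_im_logOneAddExp_le_of_re_neg {w : ℂ} (hw : w.re < 0) :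
    |(logOneAddExp w).im| ≤ Real.pi / 2 := by
  rw [logOneAddExp, if_pos hw]
  exact abs_im_log_le (re_one_add_exp_nonneg hw.le)

theorem abs_im_logOneAddExp_le_of_re_nonneg {w : ℂ} (hw : 0 ≤ w.re) :
    |(logOneAddExp w).im| ≤ |w.im| + Real.pi / 2 := by
  rw [logOneAddExp, if_neg hw.not_gt, Complex.add_im]
  exact (abs_add_le _ _).trans
    (add_le_add le_rfl (abs_im_log_le (re_one_add_exp_nonneg (by simpa using hw))))

/-- Near the odd multiples of `iπ` the real part of `logOneAddExp w` is unbounded below, so only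
its positive part can be compared with `Re w`. -/
theorem re_le_max_re_logOneAddExp {w : ℂ} (hw : 0 ≤ w.re) :
    w.re ≤ max (logOneAddExp w).re 0 + Real.log 2 := by
  rcases le_total w.re (Real.log 2) with h | h
  · linarith [le_max_right (logOneAddExp w).re 0]
  · refine le_trans ?_ (add_le_add (le_max_left _ _) le_rfl)
    rw [logOneAddExp, if_neg hw.not_gt, Complex.add_re, Complex.log_re]
    have h1 : ‖Complex.exp (-w)‖ ≤ 1 / 2 := by
      rw [Complex.norm_exp, Complex.neg_re, Real.exp_neg, one_div]
      refine inv_anti₀ two_pos ?_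
      rwa [← Real.log_le_iff_le_exp two_pos]
    have h2 : (1 / 2 : ℝ) ≤ ‖1 + Complex.exp (-w)‖ := by
      have := norm_sub_norm_le (1 : ℂ) (-Complex.exp (-w))
      rw [norm_one, norm_neg, sub_neg_eq_add] at this
      linarith
    have h3 := Real.log_le_log (by norm_num) h2
    rw [one_div, Real.log_inv] at h3
    linarith

/-! ### The double-exponential map on the strip -/

theorem re_pi_mul_sinh (t : ℂ) :
    ((Real.pi : ℂ) * Complex.sinh t).re = Real.pi * (Real.sinh t.re * Real.cos t.im) := by
  rw [Complex.re_ofReal_mul]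
  nth_rw 1 [← Complex.re_add_im t]
  rw [Complex.sinh_add, Complex.cosh_mul_I, Complex.sinh_mul_I, ← Complex.ofReal_sinh,
    ← Complex.ofReal_cosh, ← Complex.ofReal_cos, ← Complex.ofReal_sin]
  simp only [Complex.add_re, Complex.mul_re, Complex.mul_im, Complex.ofReal_re,
    Complex.ofReal_im, Complex.I_re, Complex.I_im]
  ring

theorem im_pi_mul_sinh (t : ℂ) :
    ((Real.pi : ℂ) * Complex.sinh t).im = Real.pi * (Real.cosh t.re * Real.sin t.im) := by
  rw [Complex.im_ofReal_mul]
  nth_rw 1 [← Complex.re_add_im t]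
  rw [Complex.sinh_add, Complex.cosh_mul_I, Complex.sinh_mul_I, ← Complex.ofReal_sinh,
    ← Complex.ofReal_cosh, ← Complex.ofReal_cos, ← Complex.ofReal_sin]
  simp only [Complex.add_im, Complex.mul_re, Complex.mul_im, Complex.ofReal_re,
    Complex.ofReal_im, Complex.I_re, Complex.I_im]
  ring

/-- `t ↦ π sinh t` maps the strip `|Im t| < π / 2` into the domain of `logOneAddExp`. -/
theorem re_pi_mul_sinh_ne_zero_or {t : ℂ} (ht : |t.im| < Real.pi / 2) :
    ((Real.pi : ℂ) * Complex.sinh t).re ≠ 0 ∨ |((Real.pi : ℂ) * Complex.sinh t).im| < Real.pi := by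
  have hcos : 0 < Real.cos t.im := Real.cos_pos_of_mem_Ioo (abs_lt.1 ht)
  rw [re_pi_mul_sinh, im_pi_mul_sinh]
  by_cases h : t.re = 0
  · right
    rw [h, Real.cosh_zero, one_mul, abs_mul, abs_of_pos Real.pi_pos]
    have h1 : |Real.sin t.im| < 1 := by
      rw [← sq_lt_one_iff_abs_lt_one]
      nlinarith [Real.sin_sq_add_cos_sq t.im, pow_pos hcos 2]
    nlinarith [Real.pi_pos]
  · left
    have : Real.sinh t.re ≠ 0 := by rwa [Ne, Real.sinh_eq_zero]
    have := Real.pi_ne_zero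
    positivity

/-- The image of the strip `|Im t| ≤ d` under the double-exponential map lies, to the right of the
imaginary axis, between the two lines `|Im| = 2π + (Re + log 2) tan d`. -/
theorem abs_im_logOneAddExp_mul_cos_le {t : ℂ} {d : ℝ} (hd : d < Real.pi / 2) (ht : |t.im| ≤ d) :
    |(logOneAddExp (Real.pi * Complex.sinh t)).im| * Real.cos d ≤
      2 * Real.pi * Real.cos d +
        (max (logOneAddExp (Real.pi * Complex.sinh t)).re 0 + Real.log 2) * Real.sin d := by
  have hd0 : 0 ≤ d := (abs_nonneg _).trans ht
  have hpi := Real.pi_pos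
  have hcos : 0 < Real.cos d := Real.cos_pos_of_mem_Ioo ⟨by linarith, hd⟩
  have hsin : 0 ≤ Real.sin d := Real.sin_nonneg_of_nonneg_of_le_pi hd0 (by linarith)
  have hlog : 0 < Real.log 2 := Real.log_pos one_lt_two
  set w : ℂ := Real.pi * Complex.sinh t with hw
  have hm := le_max_right (logOneAddExp w).re 0
  rcases lt_or_ge w.re 0 with h | h
  · have h1 := abs_im_logOneAddExp_le_of_re_neg h
    have h2 : 0 ≤ (max (logOneAddExp w).re 0 + Real.log 2) * Real.sin d := by positivity
    nlinarith
  · have h1 := abs_im_logOneAddExp_le_of_re_nonneg h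
    have h2 := re_le_max_re_logOneAddExp h
    have hcosy : 0 < Real.cos t.im :=
      Real.cos_pos_of_mem_Ioo (abs_lt.1 (ht.trans_lt hd))
    have hre : w.re = Real.pi * (Real.sinh t.re * Real.cos t.im) := re_pi_mul_sinh t
    have him : |w.im| = Real.pi * (Real.cosh t.re * |Real.sin t.im|) := by
      rw [hw, im_pi_mul_sinh, abs_mul, abs_mul, abs_of_pos hpi, abs_of_pos (Real.cosh_pos _)]
    have hs : 0 ≤ Real.sinh t.re := by
      rw [hre] at h
      exact nonneg_of_mul_nonneg_left (nonneg_of_mul_nonneg_right h hpi) hcosy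
    have hcs : Real.cosh t.re ≤ Real.sinh t.re + 1 := by
      nlinarith [Real.cosh_sq t.re, Real.cosh_pos t.re]
    -- `tan |Im t| ≤ tan d`
    have htan : |Real.sin t.im| * Real.cos d ≤ Real.sin d * Real.cos t.im := by
      have h3 : |Real.sin t.im| = Real.sin |t.im| := by
        rw [Real.abs_sin_eq_sin_abs_of_abs_le_pi (by linarith)]
      have h4 := Real.sin_nonneg_of_nonneg_of_le_pi (sub_nonneg.2 ht)
        (by linarith [abs_nonneg t.im])
      rw [Real.sin_sub, Real.cos_abs] at h4
      rw [h3]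
      linarith
    have h5 : |w.im| * Real.cos d ≤ w.re * Real.sin d + Real.pi * Real.cos d := by
      rw [him, hre]
      have h6 : Real.cosh t.re * |Real.sin t.im| ≤ (Real.sinh t.re) * |Real.sin t.im| + 1 := by
        nlinarith [abs_nonneg (Real.sin t.im), Real.abs_sin_le_one t.im]
      have h7 : Real.sinh t.re * (|Real.sin t.im| * Real.cos d) ≤
          Real.sinh t.re * (Real.sin d * Real.cos t.im) := by gcongr
      have h8 : Real.cosh t.re * |Real.sin t.im| * Real.cos d ≤
          Real.sinh t.re * (Real.sin d * Real.cos t.im) + Real.cos d := by nlinarith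
      nlinarith
    have h9 : w.re * Real.sin d ≤ (max (logOneAddExp w).re 0 + Real.log 2) * Real.sin d := by
      gcongr
    nlinarith [mul_le_mul_of_nonneg_right h1 hcos.le, mul_pos hpi hcos]

theorem one_add_sq_div_two_le_cosh (x : ℝ) : 1 + x ^ 2 / 2 ≤ Real.cosh x := by
  have h : Real.cosh x = 1 + 2 * Real.sinh (x / 2) ^ 2 := by
    have h1 := Real.cosh_two_mul (x / 2)
    rw [mul_div_cancel₀ x two_ne_zero] at h1
    rw [h1, Real.cosh_sq]
    ring
  have h2 : |x / 2| ≤ |Real.sinh (x / 2)| := by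
    rw [Real.abs_sinh]
    exact Real.self_le_sinh_iff.2 (abs_nonneg _)
  have h3 := sq_le_sq.2 h2
  rw [h]
  linarith

/-- A lower bound for `|(1 + exp w) (1 + exp (-w))| = 4 |cosh (w / 2)|²`, from
`2 cosh (Re w) - 2 ≥ (Re w)²`. -/
theorem sq_re_le_norm_mul_norm (w : ℂ) :
    w.re ^ 2 ≤ ‖1 + Complex.exp w‖ * ‖1 + Complex.exp (-w)‖ := by
  have key : ∀ v : ℂ, |Real.exp v.re - 1| ≤ ‖1 + Complex.exp v‖ := by
    intro v
    have := abs_norm_sub_norm_le (Complex.exp v) (-1)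
    rwa [Complex.norm_exp, norm_neg, norm_one, sub_neg_eq_add, add_comm] at this
  have hmul : Real.exp w.re * Real.exp (-w.re) = 1 := by
    rw [← Real.exp_add, add_neg_cancel, Real.exp_zero]
  calc w.re ^ 2 ≤ 2 * Real.cosh w.re - 2 := by linarith [one_add_sq_div_two_le_cosh w.re]
    _ = -((Real.exp w.re - 1) * (Real.exp (-w.re) - 1)) := by
      rw [Real.cosh_eq]; linear_combination hmul
    _ ≤ |(Real.exp w.re - 1) * (Real.exp (-w.re) - 1)| := neg_le_abs _
    _ = |Real.exp w.re - 1| * |Real.exp (-w.re) - 1| := abs_mul _ _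
    _ ≤ _ := mul_le_mul (key w) (by simpa using key (-w)) (abs_nonneg _) (norm_nonneg _)

theorem norm_cosh_le (t : ℂ) : ‖Complex.cosh t‖ ≤ Real.cosh t.re := by
  rw [Complex.cosh, norm_div, Complex.norm_ofNat, Real.cosh_eq]
  gcongr
  refine (norm_add_le _ _).trans ?_
  simp [Complex.norm_exp]

/-- The transformed exponential weight `exp (-φ(t)) φ'(t)`, which is
`π cosh t / ((1 + exp (π sinh t)) (1 + exp (-π sinh t)))`. -/
noncomputable def deWeight (t : ℂ) : ℂ :=
  Real.pi * Complex.cosh t /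
    ((1 + Complex.exp (Real.pi * Complex.sinh t)) * (1 + Complex.exp (-(Real.pi * Complex.sinh t))))

theorem exists_norm_deWeight_le {d : ℝ} (hd0 : 0 ≤ d) (hd : d < Real.pi / 2) :
    ∃ C : ℝ, 0 < C ∧ ∀ t : ℂ, |t.im| ≤ d → ‖deWeight t‖ ≤ C * (1 + t.re ^ 2)⁻¹ := by
  have hcos : 0 < Real.cos d := Real.cos_pos_of_mem_Ioo ⟨by linarith [Real.pi_pos], hd⟩
  have hpi := Real.pi_pos
  -- near the imaginary axis the weight is bounded by compactness
  obtain ⟨B, hB⟩ := (isCompact_Icc.reProdIm isCompact_Icc :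
    IsCompact (Set.Icc (-1 : ℝ) 1 ×ℂ Set.Icc (-d) d)).exists_bound_of_continuousOn
    (f := deWeight) (by
      unfold deWeight
      refine ContinuousOn.div (by fun_prop) (by fun_prop) fun t ht => ?_
      have := re_pi_mul_sinh_ne_zero_or
        ((abs_le.2 (Complex.mem_reProdIm.1 ht).2).trans_lt hd)
      exact mul_ne_zero (one_add_exp_ne_zero this) (one_add_exp_neg_ne_zero this))
  have hC2 : 0 < 8 / (Real.pi * Real.cos d ^ 2) := by positivity
  refine ⟨2 * |B| + 8 / (Real.pi * Real.cos d ^ 2), by positivity, fun t ht => ?_⟩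
  rw [← div_eq_mul_inv, le_div_iff₀ (by positivity)]
  rcases le_total |t.re| 1 with h | h
  · have h1 := hB t (Complex.mem_reProdIm.2 ⟨abs_le.1 h, abs_le.1 ht⟩)
    have h2 : t.re ^ 2 ≤ 1 := (sq_le_one_iff_abs_le_one _).2 h
    calc ‖deWeight t‖ * (1 + t.re ^ 2) ≤ |B| * 2 :=
          mul_le_mul (h1.trans (le_abs_self B)) (by linarith) (by positivity) (abs_nonneg B)
      _ ≤ _ := by linarith
  · have hsinh : 1 ≤ Real.sinh t.re ^ 2 := by
      rw [one_le_sq_iff_one_le_abs, Real.abs_sinh]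
      exact h.trans (Real.self_le_sinh_iff.2 (abs_nonneg _))
    have hcosy : Real.cos d ≤ Real.cos t.im := by
      rw [← Real.cos_abs t.im]
      exact Real.cos_le_cos_of_nonneg_of_le_pi (abs_nonneg _) (by linarith) ht
    set D := ‖1 + Complex.exp (Real.pi * Complex.sinh t)‖ *
      ‖1 + Complex.exp (-(Real.pi * Complex.sinh t))‖ with hD
    have hDle : Real.pi ^ 2 * Real.cos d ^ 2 * Real.cosh t.re ^ 2 / 2 ≤ D := by
      refine le_trans ?_ (sq_re_le_norm_mul_norm _)
      rw [re_pi_mul_sinh, mul_pow, mul_pow]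
      have h1 : Real.cosh t.re ^ 2 / 2 ≤ Real.sinh t.re ^ 2 := by
        rw [Real.cosh_sq]; linarith
      have h2 : Real.cos d ^ 2 ≤ Real.cos t.im ^ 2 := by gcongr
      calc _ = Real.pi ^ 2 * (Real.cosh t.re ^ 2 / 2 * Real.cos d ^ 2) := by ring
        _ ≤ _ := by gcongr
    have hch := Real.cosh_pos t.re
    have hDpos : 0 < D := lt_of_lt_of_le (by positivity) hDle
    have hw : ‖deWeight t‖ = Real.pi * ‖Complex.cosh t‖ / D := by
      rw [deWeight, norm_div, norm_mul, norm_mul, Complex.norm_real, Real.norm_eq_abs,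
        abs_of_pos hpi]
    rw [hw, div_mul_eq_mul_div, div_le_iff₀ hDpos]
    have h3 : 1 + t.re ^ 2 ≤ 2 * Real.cosh t.re := by
      linarith [one_add_sq_div_two_le_cosh t.re]
    calc Real.pi * ‖Complex.cosh t‖ * (1 + t.re ^ 2)
        ≤ Real.pi * Real.cosh t.re * (2 * Real.cosh t.re) := by
          gcongr
          exact norm_cosh_le t
      _ ≤ 8 / (Real.pi * Real.cos d ^ 2) *
          (Real.pi ^ 2 * Real.cos d ^ 2 * Real.cosh t.re ^ 2 / 2) := by
          rw [div_mul_eq_mul_div, le_div_iff₀ (by positivity)]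
          nlinarith [show 0 < Real.pi ^ 2 * Real.cos d ^ 2 * Real.cosh t.re ^ 2 by positivity]
      _ ≤ 8 / (Real.pi * Real.cos d ^ 2) * D := by gcongr
      _ ≤ (2 * |B| + 8 / (Real.pi * Real.cos d ^ 2)) * D := by
          gcongr
          linarith [abs_nonneg B]

/-! ### Estimates for the integrand -/

theorem norm_fAlpha_le {α δ : ℝ} {z x : ℂ} (hδ : 0 < δ) (h1 : δ ≤ ‖z - Complex.I * α + x‖)
    (h2 : δ ≤ ‖z + Complex.I * α + x‖) :
    ‖fAlpha α z x‖ ≤ 1 / Real.pi / δ * ‖Complex.exp (-x)‖ := by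
  rw [fAlpha, norm_mul, norm_mul]
  gcongr
  have hc : ‖1 / (2 * (Real.pi : ℂ) * Complex.I)‖ = 1 / (2 * Real.pi) := by
    simp [abs_of_pos Real.pi_pos]
  have e1 : ‖Complex.exp (Complex.I * α)‖ = 1 := by simp [Complex.norm_exp]
  have e2 : ‖Complex.exp (-(Complex.I * α))‖ = 1 := by simp [Complex.norm_exp]
  rw [hc]
  calc _ ≤ 1 / (2 * Real.pi) * (1 / δ + 1 / δ) := by
        gcongr
        refine (norm_sub_le _ _).trans ?_
        rw [norm_div, norm_div, e1, e2]
        gcongr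
    _ = 1 / Real.pi / δ := by field_simp; norm_num

/-- The numbers `-z ± iα` have positive real part, and imaginary part at least `α - |Im z|` in
absolute value. Let `δ` be the distance from `-Re z + i (α - |Im z|)` to the line
`Im = 2π + (Re + log 2) tan d`. Then the distance from `-z ± iα` to a point `g` between this line and
its mirror image is at least `δ`; a point `g` with negative real part may be replaced by its
projection to the imaginary axis, which is closer to `-z ± iα`. Here `v` stands for
`z ± iα + g`. -/
theorem le_norm_of_abs_im_mul_cos_le {z g v : ℂ} {α d : ℝ} (hz : z.re < 0) (hsin : 0 ≤ Real.sin d)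
    (hcos : 0 ≤ Real.cos d)
    (hg : |g.im| * Real.cos d ≤ 2 * Real.pi * Real.cos d +
      (max g.re 0 + Real.log 2) * Real.sin d)
    (hre : v.re = z.re + g.re) (him : α - |z.im| - |g.im| ≤ |v.im|) :
    (α - |z.im| - 2 * Real.pi) * Real.cos d - (-z.re + Real.log 2) * Real.sin d ≤ ‖v‖ := by
  have h1 : z.re + max g.re 0 ≤ |v.re| := by
    rcases le_total 0 g.re with h | h
    · rw [max_eq_left h, ← hre]; exact le_abs_self _
    · rw [max_eq_right h]; linarith [abs_nonneg v.re]
  have h2 : |v.im| * Real.cos d + |v.re| * Real.sin d ≤ ‖v‖ := by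
    refine abs_le_of_sq_le_sq' ?_ (norm_nonneg _) |>.2
    have h3 : ‖v‖ ^ 2 = |v.re| ^ 2 + |v.im| ^ 2 := by
      rw [sq_abs, sq_abs, Complex.sq_norm, Complex.normSq_apply]; ring
    have h4 : ‖v‖ ^ 2 = (|v.re| ^ 2 + |v.im| ^ 2) * (Real.sin d ^ 2 + Real.cos d ^ 2) := by
      rw [Real.sin_sq_add_cos_sq, mul_one, h3]
    rw [h4]
    nlinarith [sq_nonneg (|v.im| * Real.sin d - |v.re| * Real.cos d)]
  nlinarith [mul_le_mul_of_nonneg_right h1 hsin, mul_le_mul_of_nonneg_right him hcos]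

theorem norm_fAlpha_le_KConst {α d : ℝ} {z g : ℂ} (hz : z.re < 0) (hsin : 0 ≤ Real.sin d)
    (hcos : 0 ≤ Real.cos d)
    (hδ : 0 < (α - |z.im| - 2 * Real.pi) * Real.cos d - (-z.re + Real.log 2) * Real.sin d)
    (hg : |g.im| * Real.cos d ≤ 2 * Real.pi * Real.cos d +
      (max g.re 0 + Real.log 2) * Real.sin d) :
    (z - Complex.I * α + g ≠ 0 ∧ z + Complex.I * α + g ≠ 0) ∧
      ‖fAlpha α z g‖ ≤ KConst z α d * ‖Complex.exp (-g)‖ := by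
  have h1 := le_norm_of_abs_im_mul_cos_le (v := z - Complex.I * α + g) (α := α) hz hsin hcos hg
    (by simp) (by
      have := abs_sub_abs_le_abs_sub α (z.im + g.im)
      have h3 := abs_add_le z.im g.im
      have h4 : (z - Complex.I * α + g).im = -(α - (z.im + g.im)) := by simp; ring
      rw [h4, abs_neg]
      linarith [le_abs_self α])
  have h2 := le_norm_of_abs_im_mul_cos_le (v := z + Complex.I * α + g) (α := α) hz hsin hcos hg
    (by simp) (by
      have := abs_sub_abs_le_abs_add α (z.im + g.im)
      have h3 := abs_add_le z.im g.im
      have h4 : (z + Complex.I * α + g).im = α + (z.im + g.im) := by simp; ring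
      rw [h4]
      linarith [le_abs_self α])
  exact ⟨⟨norm_pos_iff.1 (hδ.trans_le h1), norm_pos_iff.1 (hδ.trans_le h2)⟩,
    norm_fAlpha_le hδ h1 h2⟩

/-- The integrand `f_α(z, φ(t)) φ'(t)` produced by the double-exponential substitution, as a
function of a complex variable `t` in the strip `|Im t| < π / 2`. -/
noncomputable def deIntegrand (α : ℝ) (z t : ℂ) : ℂ :=
  fAlpha α z (logOneAddExp (Real.pi * Complex.sinh t)) *
    (1 / (1 + Complex.exp (-(Real.pi * Complex.sinh t))) * (Real.pi * Complex.cosh t))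

theorem norm_deIntegrand_le {α d : ℝ} {z t : ℂ} (hz : z.re < 0) (hd : d < Real.pi / 2)
    (hδ : 0 < (α - |z.im| - 2 * Real.pi) * Real.cos d - (-z.re + Real.log 2) * Real.sin d)
    (ht : |t.im| ≤ d) :
    DifferentiableAt ℂ (deIntegrand α z) t ∧
      ‖deIntegrand α z t‖ ≤ KConst z α d * ‖deWeight t‖ := by
  have hd0 : 0 ≤ d := (abs_nonneg _).trans ht
  have hpi := Real.pi_pos
  have hcos : 0 < Real.cos d := Real.cos_pos_of_mem_Ioo ⟨by linarith, hd⟩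
  have hsin : 0 ≤ Real.sin d := Real.sin_nonneg_of_nonneg_of_le_pi hd0 (by linarith)
  obtain ⟨⟨hp1, hp2⟩, hle⟩ := norm_fAlpha_le_KConst hz hsin hcos.le hδ
    (abs_im_logOneAddExp_mul_cos_le hd ht)
  have hdom := re_pi_mul_sinh_ne_zero_or (ht.trans_lt hd)
  have hne := one_add_exp_neg_ne_zero hdom
  constructor
  · have hG : DifferentiableAt ℂ (fun t => logOneAddExp (Real.pi * Complex.sinh t)) t :=
      DifferentiableAt.comp (f := fun t => (Real.pi : ℂ) * Complex.sinh t) t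
        (hasDerivAt_logOneAddExp hdom).differentiableAt (by fun_prop)
    unfold deIntegrand fAlpha
    fun_prop (disch := assumption)
  · rw [deIntegrand, norm_mul]
    refine (mul_le_mul_of_nonneg_right hle (norm_nonneg _)).trans (le_of_eq ?_)
    rw [mul_assoc, ← norm_mul, Complex.exp_neg, exp_logOneAddExp hdom, deWeight]
    congr 2
    field_simp

/-! ### The substitution on the real axis -/

theorem pi_mul_sinh_ofReal (x : ℝ) :
    (Real.pi : ℂ) * Complex.sinh x = ((Real.pi * Real.sinh x : ℝ) : ℂ) := by
  push_cast; rfl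

theorem logOneAddExp_pi_mul_sinh (x : ℝ) :
    logOneAddExp (Real.pi * Complex.sinh x) = (dePhi x : ℂ) := by
  rw [pi_mul_sinh_ofReal, logOneAddExp_eq_log (by simpa using Real.pi_pos), dePhi,
    Complex.ofReal_log (by positivity)]
  push_cast
  rfl

theorem hasDerivAt_dePhi (x : ℝ) :
    HasDerivAt dePhi (1 / (1 + Real.exp (-(Real.pi * Real.sinh x))) * (Real.pi * Real.cosh x)) x := by
  have h := ((((Real.hasDerivAt_sinh x).const_mul Real.pi).exp).const_add 1).log (by positivity)
  refine h.congr_deriv ?_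
  rw [Real.exp_neg]
  field_simp
  ring

theorem deIntegrand_ofReal (α : ℝ) (z : ℂ) (x : ℝ) :
    deIntegrand α z x = fAlpha α z (dePhi x : ℂ) * ((deriv dePhi x : ℝ) : ℂ) := by
  rw [deIntegrand, logOneAddExp_pi_mul_sinh, (hasDerivAt_dePhi x).deriv]
  push_cast
  rfl

theorem range_dePhi : Set.range dePhi = Set.Ioi 0 := by
  ext y
  constructor
  · rintro ⟨x, rfl⟩
    exact Real.log_pos (by linarith [Real.exp_pos (Real.pi * Real.sinh x)])
  · intro hy
    have hy1 : 0 < Real.exp y - 1 := sub_pos.2 (Real.one_lt_exp_iff.2 hy)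
    refine ⟨Real.arsinh (Real.log (Real.exp y - 1) / Real.pi), ?_⟩
    rw [dePhi, Real.sinh_arsinh, mul_div_cancel₀ _ Real.pi_ne_zero, Real.exp_log hy1,
      add_sub_cancel, Real.log_exp]

theorem IAlpha_eq_integral_deIntegrand (α : ℝ) (z : ℂ) :
    IAlpha α z = ∫ x : ℝ, deIntegrand α z x := by
  have hpos : ∀ x : ℝ, 0 < deriv dePhi x := by
    intro x
    rw [(hasDerivAt_dePhi x).deriv]
    have := Real.pi_pos
    have := Real.cosh_pos x
    positivity
  have h := MeasureTheory.integral_image_eq_integral_abs_deriv_smul (f := dePhi)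
    (f' := deriv dePhi) (s := Set.univ) MeasurableSet.univ
    (fun x _ => ((hasDerivAt_dePhi x).differentiableAt.hasDerivAt).hasDerivWithinAt)
    ((strictMono_of_deriv_pos hpos).injective.injOn) (fun x : ℝ => fAlpha α z (x : ℂ))
  rw [Set.image_univ, range_dePhi, MeasureTheory.setIntegral_univ] at h
  rw [IAlpha, h]
  congr 1
  funext x
  rw [deIntegrand_ofReal, abs_of_pos (hpos x), Complex.real_smul, mul_comm]

theorem integrableOn_fAlpha {α : ℝ} {z : ℂ} (h : |z.im| < α) :
    MeasureTheory.IntegrableOn (fun x : ℝ => fAlpha α z (x : ℂ)) (Set.Ioi (0 : ℝ)) := by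
  have h1 : ∀ x : ℝ, α - |z.im| ≤ ‖z - Complex.I * α + x‖ := by
    intro x
    refine le_trans ?_ (Complex.abs_im_le_norm _)
    have h4 : (z - Complex.I * α + x).im = -(α - z.im) := by simp
    rw [h4, abs_neg]
    linarith [le_abs_self (α - z.im), le_abs_self z.im]
  have h2 : ∀ x : ℝ, α - |z.im| ≤ ‖z + Complex.I * α + x‖ := by
    intro x
    refine le_trans ?_ (Complex.abs_im_le_norm _)
    have h4 : (z + Complex.I * α + x).im = z.im + α := by simp
    rw [h4]
    linarith [le_abs_self (z.im + α), neg_abs_le z.im]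
  have hδ : 0 < α - |z.im| := sub_pos.2 h
  refine MeasureTheory.Integrable.mono' ((integrableOn_exp_neg_Ioi 0).const_mul
    (1 / Real.pi / (α - |z.im|))) ?_ (.of_forall fun x => ?_)
  · refine Continuous.aestronglyMeasurable ?_
    unfold fAlpha
    have n1 : ∀ x : ℝ, z - Complex.I * α + x ≠ 0 := fun x => norm_pos_iff.1 (hδ.trans_le (h1 x))
    have n2 : ∀ x : ℝ, z + Complex.I * α + x ≠ 0 := fun x => norm_pos_iff.1 (hδ.trans_le (h2 x))
    fun_prop (disch := assumption)
  · simpa [Complex.norm_exp] using norm_fAlpha_le hδ (h1 x) (h2 x)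

/-! ### Truncation -/

theorem norm_deWeight_ofReal_le (x : ℝ) :
    ‖deWeight x‖ ≤ Real.pi * Real.cosh |x| * Real.exp (-(Real.pi * Real.sinh |x|)) := by
  have hpi := Real.pi_pos
  have hch := Real.cosh_pos x
  set w := Real.pi * Real.sinh x with hw
  have habs : Real.pi * Real.sinh |x| = |w| := by
    rw [hw, abs_mul, abs_of_pos hpi, Real.abs_sinh]
  have heq : deWeight x =
      ((Real.pi * Real.cosh x / ((1 + Real.exp w) * (1 + Real.exp (-w))) : ℝ) : ℂ) := by
    rw [deWeight, pi_mul_sinh_ofReal, ← hw]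
    push_cast
    rfl
  rw [heq, Complex.norm_real, Real.norm_of_nonneg (by positivity), habs, Real.cosh_abs,
    Real.exp_neg |w|, ← div_eq_mul_inv]
  gcongr
  have h1 := Real.exp_pos w
  have h2 := Real.exp_pos (-w)
  rcases abs_cases w with ⟨h, -⟩ | ⟨h, -⟩ <;> rw [h] <;> nlinarith [mul_pos h1 h2]

/-- The function `y ↦ π cosh y exp (-π sinh y)` is minus the derivative of `exp (-π sinh y)` and
decreases on `[0, ∞)`; this is the resulting lower bound for an increment. -/
theorem mul_cosh_mul_exp_le {a b : ℝ} (ha : 0 ≤ a) (hab : a ≤ b) :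
    (b - a) * (Real.pi * Real.cosh b * Real.exp (-(Real.pi * Real.sinh b))) ≤
      Real.exp (-(Real.pi * Real.sinh a)) - Real.exp (-(Real.pi * Real.sinh b)) := by
  set s := Real.sinh b - Real.sinh a with hs
  have hpi : 2 ≤ Real.pi := Real.two_le_pi
  have hca := Real.one_le_cosh a
  have h1 : Real.cosh a * (b - a) ≤ s := by
    have h2 : Real.sinh b = Real.sinh a * Real.cosh (b - a) + Real.cosh a * Real.sinh (b - a) := by
      rw [← Real.sinh_add, add_sub_cancel]
    have h3 := Real.self_le_sinh_iff.2 (sub_nonneg.2 hab)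
    have h4 := Real.one_le_cosh (b - a)
    have h5 := Real.sinh_nonneg_iff.2 ha
    rw [hs, h2]
    nlinarith [mul_nonneg h5 (sub_nonneg.2 h4),
      mul_nonneg (zero_le_one.trans hca) (sub_nonneg.2 h3)]
  have h2 : Real.cosh b ≤ Real.cosh a + s := by
    have h3 := Real.cosh_sub_sinh a
    have h4 := Real.cosh_sub_sinh b
    have h5 : Real.exp (-b) ≤ Real.exp (-a) := Real.exp_le_exp.2 (neg_le_neg hab)
    rw [hs]
    linarith
  have hba : 0 ≤ b - a := sub_nonneg.2 hab
  have hs0 : 0 ≤ s := le_trans (by positivity) h1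
  have h3 : 1 + Real.pi * s + (Real.pi * s) ^ 2 / 2 ≤ Real.exp (Real.pi * s) :=
    Real.quadratic_le_exp_of_nonneg (by positivity)
  have h4 : (b - a) * (Real.pi * Real.cosh b) ≤ Real.exp (Real.pi * s) - 1 := by
    have h5 : (b - a) * (Real.pi * Real.cosh b) ≤ (b - a) * (Real.pi * (Real.cosh a + s)) := by
      gcongr
    have h6 : Real.pi * (Real.cosh a * (b - a)) ≤ Real.pi * s := by gcongr
    have h7 : (b - a) ≤ s := le_trans (by nlinarith) h1
    have h8 : Real.pi * s * (b - a) ≤ Real.pi * s * s := by gcongr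
    have h9 : Real.pi * s * s ≤ (Real.pi * s) ^ 2 / 2 := by
      nlinarith [mul_nonneg (mul_nonneg Real.pi_pos.le (sub_nonneg.2 hpi)) (sq_nonneg s)]
    nlinarith
  have h5 : Real.exp (-(Real.pi * Real.sinh a)) =
      Real.exp (Real.pi * s) * Real.exp (-(Real.pi * Real.sinh b)) := by
    rw [← Real.exp_add, hs]; ring_nf
  rw [h5, ← mul_assoc]
  nlinarith [mul_le_mul_of_nonneg_right h4 (Real.exp_pos (-(Real.pi * Real.sinh b))).le]

/-- The increments of `mul_cosh_mul_exp_le` telescope. -/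
theorem exists_hasSum_cosh_mul_exp_le {h : ℝ} (hh : 0 < h) (n : ℕ) :
    ∃ S ≤ Real.exp (-(Real.pi * Real.sinh (n * h))),
      HasSum (fun j : ℕ => h * (Real.pi * Real.cosh ((j + n + 1 : ℕ) * h) *
        Real.exp (-(Real.pi * Real.sinh ((j + n + 1 : ℕ) * h))))) S := by
  set u : ℕ → ℝ := fun j => h * (Real.pi * Real.cosh ((j + n + 1 : ℕ) * h) *
        Real.exp (-(Real.pi * Real.sinh ((j + n + 1 : ℕ) * h)))) with hu
  have h0 : ∀ j, 0 ≤ u j := by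
    intro j
    have := Real.pi_pos
    have := Real.cosh_pos ((j + n + 1 : ℕ) * h)
    positivity
  have hle : ∀ m, ∑ j ∈ Finset.range m, u j ≤ Real.exp (-(Real.pi * Real.sinh (n * h))) := by
    intro m
    calc ∑ j ∈ Finset.range m, u j ≤ ∑ j ∈ Finset.range m,
          (Real.exp (-(Real.pi * Real.sinh ((j + n : ℕ) * h))) -
            Real.exp (-(Real.pi * Real.sinh ((j + 1 + n : ℕ) * h)))) := by
          refine Finset.sum_le_sum fun j _ => ?_
          have := mul_cosh_mul_exp_le (a := (j + n : ℕ) * h) (b := (j + n + 1 : ℕ) * h)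
            (by positivity) (by push_cast; nlinarith)
          rw [show ((j + n + 1 : ℕ) : ℝ) * h - (j + n : ℕ) * h = h by push_cast; ring] at this
          rw [add_right_comm j 1 n]
          exact this
      _ = Real.exp (-(Real.pi * Real.sinh ((0 + n : ℕ) * h))) -
            Real.exp (-(Real.pi * Real.sinh ((m + n : ℕ) * h))) :=
          Finset.sum_range_sub' (fun j => Real.exp (-(Real.pi * Real.sinh ((j + n : ℕ) * h)))) m
      _ ≤ _ := by
          rw [zero_add]
          linarith [Real.exp_pos (-(Real.pi * Real.sinh ((m + n : ℕ) * h)))]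
  have hs := summable_of_sum_range_le h0 hle
  exact ⟨_, hs.tsum_le_of_sum_range_le hle, hs.hasSum⟩

/-! ### The error of the double-exponential formula -/

theorem norm_IAlpha_sub_deApprox_le {α d C h : ℝ} {z : ℂ} (hz : z.re < 0) (hd0 : 0 < d)
    (hd : d < Real.pi / 2)
    (hδ : 0 < (α - |z.im| - 2 * Real.pi) * Real.cos d - (-z.re + Real.log 2) * Real.sin d)
    (hC : ∀ t : ℂ, |t.im| ≤ d → ‖deWeight t‖ ≤ C * (1 + t.re ^ 2)⁻¹) (hh : 0 < h) (n : ℕ) :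
    ‖IAlpha α z - deApprox α n h z‖ ≤
      2 * (KConst z α d * C * Real.pi * (Real.exp (-(2 * Real.pi * d / h)) /
        (1 - Real.exp (-(2 * Real.pi * d / h))))) +
      2 * (KConst z α d * Real.exp (-(Real.pi * Real.sinh (n * h)))) := by
  have hK : 0 ≤ KConst z α d := by
    have := Real.pi_pos
    unfold KConst
    positivity
  have hdisc := norm_integral_sub_tsum_le (F := deIntegrand α z) (M := KConst z α d * C) hd0 hh
    (fun t ht => (norm_deIntegrand_le hz hd hδ ht).1) (fun t ht => by
      rw [mul_assoc]
      exact (norm_deIntegrand_le hz hd hδ ht).2.trans (mul_le_mul_of_nonneg_left (hC t ht) hK))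
  obtain ⟨S, hS, hsum⟩ := exists_hasSum_cosh_mul_exp_le hh n
  have htrunc := (norm_tsum_sub_sum_Icc_le (n := n)
    (f := fun k : ℤ => (h : ℂ) * deIntegrand α z ((k * h : ℝ) : ℂ))
    (u := fun j : ℕ => KConst z α d * (h * (Real.pi * Real.cosh (j * h) *
      Real.exp (-(Real.pi * Real.sinh (j * h)))))) (hsum.mul_left _) (fun k _ => by
      rw [norm_mul, Complex.norm_real, Real.norm_of_nonneg hh.le, mul_left_comm]
      refine mul_le_mul_of_nonneg_left ?_ hh.le
      have h1 := (norm_deIntegrand_le (t := ((k * h : ℝ) : ℂ)) hz hd hδ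
        (by rw [Complex.ofReal_im, abs_zero]; exact hd0.le)).2
      have h2 := norm_deWeight_ofReal_le (k * h)
      rw [abs_mul, abs_of_pos hh] at h2
      rw [Nat.cast_natAbs, Int.cast_abs]
      exact h1.trans (mul_le_mul_of_nonneg_left h2 hK))).2
  rw [tsum_mul_left] at htrunc
  have hDE : deApprox α n h z =
      ∑ k ∈ Finset.Icc (-(n : ℤ)) n, (h : ℂ) * deIntegrand α z ((k * h : ℝ) : ℂ) := by
    rw [deApprox, Finset.mul_sum]
    refine Finset.sum_congr rfl fun k _ => ?_
    rw [deIntegrand_ofReal]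
  rw [IAlpha_eq_integral_deIntegrand, hDE, ← sub_add_sub_cancel]
  exact (norm_add_le _ _).trans (add_le_add hdisc (htrunc.trans (by gcongr)))

theorem exp_neg_pi_mul_sinh_log_le {u : ℝ} (hu : 1 ≤ u) :
    Real.exp (-(Real.pi * Real.sinh (Real.log u))) ≤
      Real.exp (Real.pi / 2) * Real.exp (-(Real.pi / 2 * u)) := by
  rw [← Real.exp_add, Real.sinh_log (by linarith)]
  have := inv_le_one_of_one_le₀ hu
  refine Real.exp_le_exp.2 ?_
  nlinarith [Real.pi_pos]

theorem theorem2 :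
    ∃ c : ℝ → ℝ, (∀ d : ℝ, 0 < c d) ∧
      ∀ (z : ℂ) (α d : ℝ), z.re < 0 → |z.im| + 2 * Real.pi < α →
        0 < d →
        d < Real.arctan ((α - |z.im| - 2 * Real.pi) / (-z.re + Real.log 2)) →
        MeasureTheory.IntegrableOn (fun x : ℝ => fAlpha α z (x : ℂ)) (Set.Ioi (0 : ℝ)) ∧
        ∀ n : ℕ, 0 < n → 1 / (4 * d) < (n : ℝ) →
          ‖IAlpha α z - deApprox α n (Real.log (4 * d * (n : ℝ)) / (n : ℝ)) z‖ ≤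
            c d * KConst z α d *
              Real.exp (-(2 * Real.pi * d * (n : ℝ) / Real.log (4 * d * (n : ℝ)))) := by
  have hpi := Real.pi_pos
  suffices H : ∀ d : ℝ, ∃ c : ℝ, 0 < c ∧ ∀ (z : ℂ) (α : ℝ), z.re < 0 → |z.im| + 2 * Real.pi < α →
      0 < d → d < Real.arctan ((α - |z.im| - 2 * Real.pi) / (-z.re + Real.log 2)) →
        ∀ n : ℕ, 0 < n → 1 / (4 * d) < (n : ℝ) →
          ‖IAlpha α z - deApprox α n (Real.log (4 * d * (n : ℝ)) / (n : ℝ)) z‖ ≤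
            c * KConst z α d *
              Real.exp (-(2 * Real.pi * d * (n : ℝ) / Real.log (4 * d * (n : ℝ)))) by
    choose c hc0 hc using H
    exact ⟨c, hc0, fun z α d hz hα hd0 hd =>
      ⟨integrableOn_fAlpha (by linarith), hc d z α hz hα hd0 hd⟩⟩
  intro d
  by_cases hdr : 0 < d ∧ d < Real.pi / 2
  swap
  · exact ⟨1, one_pos, fun z α _ _ hd0 hd _ _ _ =>
      absurd ⟨hd0, hd.trans (Real.arctan_lt_pi_div_two _)⟩ hdr⟩
  obtain ⟨hd0, hd⟩ := hdr
  obtain ⟨C, hC0, hC⟩ := exists_norm_deWeight_le hd0.le hd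
  -- the logarithm is bounded below by its value at the least admissible `n`
  set L := Real.log (4 * d * ((⌊1 / (4 * d)⌋₊ + 1 : ℕ) : ℝ)) with hL
  have hL1 : 1 < 4 * d * ((⌊1 / (4 * d)⌋₊ + 1 : ℕ) : ℝ) := by
    have := Nat.lt_floor_add_one (1 / (4 * d))
    rw [div_lt_iff₀ (by positivity)] at this
    push_cast
    linarith
  have hL0 : 0 < L := Real.log_pos hL1
  set X := Real.pi / 2 * Real.exp 1 / L with hX
  refine ⟨4 * Real.pi * C + 2 * (Real.exp (Real.pi / 2) * Real.exp X), by positivity, ?_⟩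
  intro z α hz hα _ hdα n hn hdn
  have hb : 0 < -z.re + Real.log 2 := by linarith [Real.log_pos one_lt_two]
  have hcos : 0 < Real.cos d := Real.cos_pos_of_mem_Ioo ⟨by linarith, hd⟩
  have hδ : 0 < (α - |z.im| - 2 * Real.pi) * Real.cos d - (-z.re + Real.log 2) * Real.sin d := by
    have h1 := Real.tan_lt_tan_of_lt_of_lt_pi_div_two (by linarith)
      (Real.arctan_lt_pi_div_two _) hdα
    rw [Real.tan_arctan, Real.tan_eq_sin_div_cos, div_lt_div_iff₀ hcos hb] at h1
    linarith
  have hK : 0 ≤ KConst z α d := by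
    unfold KConst
    positivity
  have hn' : (0 : ℝ) < n := by exact_mod_cast hn
  set u := 4 * d * (n : ℝ) with hu
  have hu1 : 1 < u := by
    rw [div_lt_iff₀ (by positivity)] at hdn
    linarith
  have hlu : 0 < Real.log u := Real.log_pos hu1
  have hLu : L ≤ Real.log u := by
    refine Real.log_le_log (by linarith) ?_
    have h1 : ⌊1 / (4 * d)⌋₊ + 1 ≤ n := (Nat.floor_lt (by positivity)).2 hdn
    have h2 : ((⌊1 / (4 * d)⌋₊ + 1 : ℕ) : ℝ) ≤ n := by exact_mod_cast h1
    rw [hu]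
    gcongr
  have hexp : 2 * Real.pi * d / (Real.log u / n) = 2 * Real.pi * d * n / Real.log u := by
    field_simp
  have hexp' : 2 * Real.pi * d * n = Real.pi / 2 * u := by rw [hu]; ring
  have main := norm_IAlpha_sub_deApprox_le (h := Real.log u / n) hz hd0 hd hδ hC (by positivity) n
  rw [hexp, hexp', mul_div_cancel₀ _ hn'.ne'] at main
  rw [hexp']
  set q := Real.exp (-(Real.pi / 2 * u / Real.log u)) with hq
  have hq0 : 0 < q := Real.exp_pos _
  have hq2 : q ≤ 1 / 2 := by
    have h1 : 1 ≤ Real.pi / 2 * u / Real.log u := by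
      rw [le_div_iff₀ hlu]
      nlinarith [Real.two_le_pi, Real.log_le_sub_one_of_pos (zero_lt_one.trans hu1)]
    rw [hq, Real.exp_neg, one_div]
    refine inv_anti₀ two_pos ?_
    linarith [Real.add_one_le_exp (Real.pi / 2 * u / Real.log u)]
  have hdisc : q / (1 - q) ≤ 2 * q := by
    rw [div_le_iff₀ (by linarith)]
    nlinarith
  have htrunc : Real.exp (-(Real.pi / 2 * u)) ≤ Real.exp X * q := by
    rw [hq, ← Real.exp_add]
    refine Real.exp_le_exp.2 ?_
    have hX0 : 0 ≤ X := by positivity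
    suffices Real.pi / 2 * u / Real.log u ≤ Real.pi / 2 * u + X by linarith
    rcases le_total 1 (Real.log u) with h | h
    · have : Real.pi / 2 * u / Real.log u ≤ Real.pi / 2 * u := div_le_self (by positivity) h
      linarith
    · have h1 : u ≤ Real.exp 1 := (Real.log_le_iff_le_exp (by linarith)).1 h
      have h2 : Real.pi / 2 * u / Real.log u ≤ X := by
        rw [hX]
        gcongr
      have : 0 ≤ Real.pi / 2 * u := by positivity
      linarith
  calc _ ≤ _ := main
    _ ≤ 2 * (KConst z α d * C * Real.pi * (2 * q)) +
        2 * (KConst z α d * (Real.exp (Real.pi / 2) * (Real.exp X * q))) := by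
      gcongr
      exact (exp_neg_pi_mul_sinh_log_le hu1.le).trans (by gcongr)
    _ = _ := by ring
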